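/- Let $G$ be a finite group and let $\operatorname{Irr}(G)$ be the set of its irreducible complex characters. For $\chi\in\operatorname{Irr}(G)$ put $\mathbb{Q}(\chi)=\mathbb{Q}(\chi(g): g\in G)$, and for $x\in G$ put $\mathbb{Q}(x)=\mathbb{Q}(\psi(x):\psi\in\operatorname{Irr}(G))$. The character $\chi$ is called rational if $\mathbb{Q}(\chi)=\mathbb{Q}$ and quadratic if $[\mathbb{Q}(\chi):\mathbb{Q}]=2$; the conjugacy class of $x$ is called rational if $\mathbb{Q}(x)=\mathbb{Q}$ and quadratic if $[\mathbb{Q}(x):\mathbb{Q}]=2$. The group $G$ is called semi-rational if for every $x\in G$ the generators of $\langle x\rangle$ lie in a union of at most two conjugacy classes of $G$; uniformly semi-rational if there is an integer $m$ such that for every $x\in G$ each generator of $\langle x\rangle$ is conjugate in $G$ to $x$ or to $x^m$; quadratic rational if every $\chi\in\operatorname{Irr}(G)$ is rational or quadratic; and quadratic semi-rational if it is both semi-rational and quadratic rational. Then: (1) If $G$ is quadratic semi-rational, then the number of rational irreducible characters of $G$ equals the number of rational conjugacy classes of $G$. (2) If $G$ is uniformly semi-rational, then the number of rational irreducible characters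 of $G$ equals the number of rational conjugacy classes of $G$. (3) If $G$ is quadratic semi-rational, then the number of quadratic irreducible characters of $G$ equals the number of quadratic conjugacy classes of $G$. -/

import Mathlib

noncomputable section

namespace SemiRational

/-- `Irr(G)`: the set of characters of irreducible complex representations of `G`.
Every finite-dimensional complex space is isomorphic to some `ℂⁿ`, so it suffices to let the
representations act on the spaces `Fin n → ℂ`. -/
def Irr (G : Type*) [Group G] : Set (G → ℂ) :=
  {χ | ∃ (n : ℕ) (ρ : Representation ℂ G (Fin n → ℂ)), ρ.IsIrreducible ∧ ρ.character = χ}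

/-- `ℚ(χ)`: the subfield of `ℂ` generated by the values of `χ`. -/
def charField {G : Type*} (χ : G → ℂ) : IntermediateField ℚ ℂ :=
  IntermediateField.adjoin ℚ (Set.range χ)

/-- `ℚ(x)`: the subfield of `ℂ` generated by the values at `x` of all irreducible characters. -/
def elementField {G : Type*} [Group G] (x : G) : IntermediateField ℚ ℂ :=
  IntermediateField.adjoin ℚ {z : ℂ | ∃ χ ∈ Irr G, χ x = z}

/-- The rational irreducible characters: `ℚ(χ) = ℚ`. -/
def rationalIrr (G : Type*) [Group G] : Set (G → ℂ) :=
  {χ | χ ∈ Irr G ∧ charField χ = ⊥}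

/-- The quadratic irreducible characters: `[ℚ(χ) : ℚ] = 2`. -/
def quadraticIrr (G : Type*) [Group G] : Set (G → ℂ) :=
  {χ | χ ∈ Irr G ∧ Module.finrank ℚ (charField χ) = 2}

/-- The rational conjugacy classes: the classes of the elements `x` with `ℚ(x) = ℚ`. -/
def rationalClasses (G : Type*) [Group G] : Set (ConjClasses G) :=
  {C | ∃ x : G, ConjClasses.mk x = C ∧ elementField x = ⊥}

/-- The quadratic conjugacy classes: the classes of the elements `x` with `[ℚ(x) : ℚ] = 2`. -/
def quadraticClasses (G : Type*) [Group G] : Set (ConjClasses G) :=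
  {C | ∃ x : G, ConjClasses.mk x = C ∧ Module.finrank ℚ (elementField x) = 2}

/-- `x` is semi-rational: the generators of `⟨x⟩` lie in a union of at most two
conjugacy classes of `G`. -/
def IsSemiRationalElement {G : Type*} [Group G] (x : G) : Prop :=
  ∃ C D : ConjClasses G, ∀ y : G, Subgroup.zpowers y = Subgroup.zpowers x →
    ConjClasses.mk y = C ∨ ConjClasses.mk y = D

/-- `G` is semi-rational: all its elements are semi-rational. -/
def IsSemiRational (G : Type*) [Group G] : Prop :=
  ∀ x : G, IsSemiRationalElement x

/-- `G` is quadratic rational: each irreducible character is rational or quadratic. -/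
def IsQuadraticRational (G : Type*) [Group G] : Prop :=
  ∀ χ ∈ Irr G, charField χ = ⊥ ∨ Module.finrank ℚ (charField χ) = 2

/-- `G` is quadratic semi-rational: it is both semi-rational and quadratic rational. -/
def IsQuadraticSemiRational (G : Type*) [Group G] : Prop :=
  IsSemiRational G ∧ IsQuadraticRational G

/-- `G` is uniformly semi-rational: for one integer `m` and all `x`, every generator of `⟨x⟩`
is conjugate to `x` or to `x ^ m`. -/
def IsUniformlySemiRational (G : Type*) [Group G] : Prop :=
  ∃ m : ℤ, ∀ x y : G, Subgroup.zpowers y = Subgroup.zpowers x → IsConj y x ∨ IsConj y (x ^ m)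

end SemiRational

end

open Module

/-! Let U be the group of units modulo |G|. It acts on conjugacy classes by powers and on
irreducible characters by χ ↦ χ(g^u), which is Galois conjugation over the field of |G|-th roots of
unity. By Galois theory, the degrees of ℚ(χ) and ℚ(x) are the indices of the stabilizers in U
(`finrank_charField_eq_index`, `finrank_elementField_eq_index`), so rational means fixed by U and
quadratic means lying in an orbit of size two.

Irreducible characters and class indicators are two bases of the class functions. Each u permutes
both, so comparing traces shows that u has equally many fixed points on characters and on classes
(`card_fixedBy_Irr_eq`).

In the quadratic semi-rational case all orbits on both sides have size 1 or 2. With a fixed points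
and b points in orbits of size 2, the fixed-point counts sum to |U|(a + b/2), while u = 1 gives a +
b; together these determine a and b.

In the uniform case the exponent m can be replaced by a unit u
(`exists_unit_of_isUniformlySemiRational`). Rational then means fixed by this single u, and the
equality of fixed-point counts at u suffices. -/

theorem Representation.IsIrreducible.of_semilinearEquiv {G k V W : Type*} [Group G] [Field k]
    [AddCommGroup V] [Module k V] [AddCommGroup W] [Module k W] {τ τ' : k →+* k}
    [RingHomInvPair τ τ'] [RingHomInvPair τ' τ]
    {ρ : Representation k G V} {σ : Representation k G W} (e : V ≃ₛₗ[τ] W)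
    (he : ∀ g v, e (ρ g v) = σ g (e v)) (hρ : ρ.IsIrreducible) : σ.IsIrreducible := by
  let F (p : Subrepresentation σ) : Subrepresentation ρ :=
    { toSubmodule := p.toSubmodule.comap e.toLinearMap
      apply_mem_toSubmodule := fun g v hv ↦ by
        simpa [he] using p.apply_mem_toSubmodule g hv }
  have hF (p : Subrepresentation σ) (v : V) : v ∈ (F p).toSubmodule ↔ e v ∈ p.toSubmodule := by
    simp [F]
  have hV : Nontrivial V := by
    by_contra h
    rw [not_nontrivial_iff_subsingleton] at h
    obtain ⟨p, q, hpq⟩ := hρ.toNontrivial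
    exact hpq (Subrepresentation.toSubmodule_injective (Subsingleton.elim _ _))
  have hW : Nontrivial W := e.symm.toEquiv.nontrivial
  have : Nontrivial (Subrepresentation σ) := by
    refine ⟨⊥, ⊤, fun h ↦ ?_⟩
    have h' : (⊥ : Submodule k W) = ⊤ := congrArg Subrepresentation.toSubmodule h
    exact bot_ne_top h'
  refine ⟨fun p ↦ ?_⟩
  rcases hρ.eq_bot_or_eq_top (F p) with h | h
  · left
    have h' : (F p).toSubmodule = ⊥ := congrArg Subrepresentation.toSubmodule h
    refine Subrepresentation.toSubmodule_injective
      (show p.toSubmodule = ⊥ from (Submodule.eq_bot_iff _).2 fun w hw ↦ ?_)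
    have : e.symm w ∈ (F p).toSubmodule := by simpa [hF] using hw
    rw [h', Submodule.mem_bot] at this
    simpa using this
  · right
    have h' : (F p).toSubmodule = ⊤ := congrArg Subrepresentation.toSubmodule h
    refine Subrepresentation.toSubmodule_injective
      (show p.toSubmodule = ⊤ from (Submodule.eq_top_iff').2 fun w ↦ ?_)
    have : e.symm w ∈ (F p).toSubmodule := h' ▸ Submodule.mem_top
    simpa [hF] using this

/-! ### Irreducible characters as a basis of the class functions. -/

namespace SemiRational

variable {G : Type*} [Group G]

theorem character_mem_Irr {V : Type*} [AddCommGroup V] [Module ℂ V] [FiniteDimensional ℂ V]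
    (ρ : Representation ℂ G V) (hρ : ρ.IsIrreducible) : ρ.character ∈ Irr G := by
  let e := (finBasis ℂ V).equivFun
  let σ : Representation ℂ G (Fin (finrank ℂ V) → ℂ) :=
    { toFun := fun g ↦ e.conj (ρ g)
      map_one' := by ext; simp
      map_mul' := fun a b ↦ by ext; simp }
  refine ⟨finrank ℂ V, σ, hρ.of_semilinearEquiv e fun g v ↦ ?_, ?_⟩
  · simp [σ, LinearEquiv.conj_apply]
  · ext g
    exact LinearMap.trace_conj' (ρ g) e

theorem Irr.apply_eq_of_isConj {χ : G → ℂ} (hχ : χ ∈ Irr G) {x y : G} (h : IsConj x y) :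
    χ x = χ y := by
  obtain ⟨n, ρ, -, rfl⟩ := hχ
  obtain ⟨c, rfl⟩ := isConj_iff.1 h
  simp

theorem sum_character_mul_character_inv [Fintype G] {χ ψ : G → ℂ} (hχ : χ ∈ Irr G)
    (hψ : ψ ∈ Irr G) : ∑ g, χ g * ψ g⁻¹ = if χ = ψ then (Nat.card G : ℂ) else 0 := by
  classical
  have hc : (Nat.card G : ℂ) ≠ 0 := by simp
  let _ : Invertible (Nat.card G : ℂ) := invertibleOfNonzero hc
  obtain ⟨n, ρ, hρ, rfl⟩ := hχ
  obtain ⟨m, σ, hσ, rfl⟩ := hψ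
  split_ifs with h
  · have := Representation.char_orthonormal ρ ρ
    rw [if_pos ⟨.refl ρ⟩, inv_mul_eq_iff_eq_mul₀ hc, mul_one] at this
    rw [← h, this]
  · have := Representation.char_orthonormal ρ σ
    rw [if_neg (fun ⟨φ⟩ ↦ h (Representation.char_iso φ).symm), inv_mul_eq_iff_eq_mul₀ hc,
      mul_zero] at this
    exact this

theorem linearIndependent_Irr [Finite G] :
    LinearIndependent ℂ (Subtype.val : Irr G → G → ℂ) := by
  classical
  have := Fintype.ofFinite G
  rw [linearIndependent_iff']
  intro s c hc ψ hψ
  have h : ∑ g, (∑ χ ∈ s, c χ • χ.1) g * ψ.1 g⁻¹ = c ψ * Nat.card G := by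
    simp only [Finset.sum_apply, Pi.smul_apply, smul_eq_mul, Finset.sum_mul, mul_assoc]
    rw [Finset.sum_comm]
    simp only [← Finset.mul_sum, sum_character_mul_character_inv (Subtype.prop _) ψ.2]
    simp [Subtype.val_inj, hψ]
  rw [hc] at h
  simpa using h.symm

/-- A central element of the group algebra acts as zero on every irreducible representation on which
its trace vanishes. -/
theorem asAlgebraHom_eq_zero_of_trace_eq_zero {k V : Type*} [Field k] [IsAlgClosed k] [CharZero k]
    [AddCommGroup V] [Module k V]
    [FiniteDimensional k V] (ρ : Representation k G V) [hρ : ρ.IsIrreducible]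
    {a : MonoidAlgebra k G} (ha : ∀ g, Commute (MonoidAlgebra.of k G g) a)
    (htr : LinearMap.trace k V (ρ.asAlgebraHom a) = 0) : ρ.asAlgebraHom a = 0 := by
  -- Schur's lemma: a central element acts by a scalar c, and its trace c · dim V vanishes only if c
  -- = 0.
  let T : ρ.IntertwiningMap ρ :=
    { toLinearMap := ρ.asAlgebraHom a
      isIntertwining' := fun g ↦ by
        have := congrArg ρ.asAlgebraHom (ha g).eq
        rw [map_mul, map_mul, ρ.asAlgebraHom_of] at this
        exact this.symm }
  obtain ⟨c, hc⟩ :=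
    Representation.IsIrreducible.algebraMap_intertwiningMap_bijective_of_isAlgClosed.2 T
  have hV : Nontrivial V := by
    by_contra h
    rw [not_nontrivial_iff_subsingleton] at h
    obtain ⟨p, q, hpq⟩ := hρ.toNontrivial
    exact hpq (Subrepresentation.toSubmodule_injective (Subsingleton.elim _ _))
  have hT : ρ.asAlgebraHom a = c • LinearMap.id := by
    have := congrArg Representation.IntertwiningMap.toLinearMap hc
    exact this.symm
  rw [hT, map_smul, LinearMap.trace_id, smul_eq_mul, mul_eq_zero] at htr
  rcases htr with h | h
  · rw [hT, h, zero_smul]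
  · exact absurd h (by exact_mod_cast finrank_pos.ne')

/-- A semisimple module is the sum of its simple submodules. -/
theorem smul_eq_zero_of_forall_isSimpleModule {R M : Type*} [Ring R] [AddCommGroup M] [Module R M]
    [IsSemisimpleModule R M] (a : R)
    (ha : ∀ N : Submodule R M, IsSimpleModule R N → ∀ x ∈ N, a • x = 0) (x : M) : a • x = 0 := by
  have hx : x ∈ sSup {N : Submodule R M | IsSimpleModule R N} := by
    rw [IsSemisimpleModule.sSup_simples_eq_top]; trivial
  rw [sSup_eq_iSup'] at hx
  induction hx using Submodule.iSup_induction' with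
  | mem N x hx => exact ha N.1 N.2 x hx
  | zero => exact smul_zero a
  | add x y _ _ hx hy => rw [smul_add, hx, hy, add_zero]

theorem asAlgebraHom_ofModule' {k : Type*} [Field k] {M : Type*} [AddCommGroup M]
    [Module k M] [Module (MonoidAlgebra k G) M] [IsScalarTower k (MonoidAlgebra k G) M]
    (a : MonoidAlgebra k G) (x : M) :
    (Representation.ofModule' M : Representation k G M).asAlgebraHom a x = a • x := by
  have : (Representation.ofModule' M : Representation k G M).asAlgebraHom =
      Algebra.lsmul k k M := (MonoidAlgebra.lift k (M →ₗ[k] M) G).apply_symm_apply _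
  rw [this]
  rfl

theorem isIrreducible_ofModule' {k : Type*} [Field k] {M : Type*} [AddCommGroup M]
    [Module k M] [Module (MonoidAlgebra k G) M] [IsScalarTower k (MonoidAlgebra k G) M]
    [IsSimpleModule (MonoidAlgebra k G) M] :
    (Representation.ofModule' M : Representation k G M).IsIrreducible := by
  have : Nontrivial M := IsSimpleModule.nontrivial (MonoidAlgebra k G) M
  have : Nontrivial (Subrepresentation (Representation.ofModule' M : Representation k G M)) := by
    refine ⟨⊥, ⊤, fun h ↦ ?_⟩
    have h' : (⊥ : Submodule k M) = ⊤ := congrArg Subrepresentation.toSubmodule h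
    exact bot_ne_top h'
  refine ⟨fun p ↦ ?_⟩
  let q : Submodule (MonoidAlgebra k G) M :=
    { p.toSubmodule with
      smul_mem' := fun a x hx ↦ by
        change a • x ∈ p.toSubmodule
        change x ∈ p.toSubmodule at hx
        rw [← asAlgebraHom_ofModule', Representation.asAlgebraHom_def,
          MonoidAlgebra.lift_apply, Finsupp.sum, LinearMap.sum_apply]
        exact Submodule.sum_mem _ fun g _ ↦
          p.toSubmodule.smul_mem _ (p.apply_mem_toSubmodule g hx) }
  have hq (x : M) : x ∈ p.toSubmodule ↔ x ∈ q := Iff.rfl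
  refine (eq_bot_or_eq_top q).imp (fun h ↦ ?_) fun h ↦ ?_
  · refine Subrepresentation.toSubmodule_injective (Submodule.ext fun x ↦ ?_)
    rw [hq, h]
    exact Iff.rfl
  · refine Subrepresentation.toSubmodule_injective (Submodule.ext fun x ↦ ?_)
    rw [hq, h]
    exact Iff.rfl

/-- The element Σ f(g) g is central and has trace zero on every irreducible representation, so it
kills every simple submodule of the regular module. By semisimplicity it kills 1, hence is zero. -/
theorem eq_zero_of_sum_mul_eq_zero [Fintype G] {f : G → ℂ} (hf : ∀ g h, f (h * g * h⁻¹) = f g)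
    (h0 : ∀ χ ∈ Irr G, ∑ g, f g * χ g = 0) : f = 0 := by
  classical
  let a : MonoidAlgebra ℂ G := ∑ g, f g • MonoidAlgebra.of ℂ G g
  have ha (h : G) : Commute (MonoidAlgebra.of ℂ G h) a := by
    change _ * _ = _ * _
    simp only [a, Finset.mul_sum, Finset.sum_mul, mul_smul_comm, smul_mul_assoc, ← map_mul]
    refine Fintype.sum_equiv (MulAut.conj h).toEquiv _ _ fun g ↦ ?_
    simp [hf]
  have hsimple (N : Submodule (MonoidAlgebra ℂ G) (MonoidAlgebra ℂ G))
      (hN : IsSimpleModule (MonoidAlgebra ℂ G) N) (x) (hx : x ∈ N) : a • x = 0 := by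
    have hρ : (Representation.ofModule' N : Representation ℂ G N).IsIrreducible :=
      isIrreducible_ofModule'
    have htr : LinearMap.trace ℂ N
        ((Representation.ofModule' N : Representation ℂ G N).asAlgebraHom a) = 0 := by
      simpa [a, Representation.asAlgebraHom_of, Representation.character] using
        h0 _ (character_mem_Irr _ hρ)
    have h := LinearMap.congr_fun (asAlgebraHom_eq_zero_of_trace_eq_zero _ ha htr) (⟨x, hx⟩ : N)
    rw [asAlgebraHom_ofModule'] at h
    exact congrArg Subtype.val h
  have ha0 : a = 0 := by
    simpa using smul_eq_zero_of_forall_isSimpleModule a hsimple 1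
  ext g
  have := congrArg (fun b : MonoidAlgebra ℂ G ↦ b.coeff g) ha0
  simpa [a, MonoidAlgebra.of_apply, Finsupp.finsetSum_apply, Finsupp.single_apply] using this

/-- The function on conjugacy classes induced by an irreducible character. -/
noncomputable def Irr.onClasses (χ : Irr G) (C : ConjClasses G) : ℂ :=
  Quotient.lift χ.1 (fun _ _ h ↦ Irr.apply_eq_of_isConj χ.2 h) C

@[simp]
theorem Irr.onClasses_mk (χ : Irr G) (x : G) : Irr.onClasses χ (ConjClasses.mk x) = χ.1 x := rfl

theorem linearIndependent_onClasses [Finite G] :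
    LinearIndependent ℂ (Irr.onClasses : Irr G → ConjClasses G → ℂ) :=
  LinearIndependent.of_comp (LinearMap.funLeft ℂ ℂ (ConjClasses.mk : G → ConjClasses G))
    linearIndependent_Irr

theorem span_onClasses [Finite G] :
    Submodule.span ℂ (Set.range (Irr.onClasses : Irr G → ConjClasses G → ℂ)) = ⊤ := by
  classical
  have := Fintype.ofFinite G
  have := Fintype.ofFinite (ConjClasses G)
  by_contra hne
  obtain ⟨φ, hφ, hle⟩ := Submodule.exists_le_ker_of_lt_top _ (lt_top_iff_ne_top.2 hne)
  let N (C : ConjClasses G) : ℂ := (Finset.univ.filter fun g : G ↦ ConjClasses.mk g = C).card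
  have hN (C : ConjClasses G) : N C ≠ 0 := by
    obtain ⟨g, rfl⟩ := ConjClasses.mk_surjective C
    have : (Finset.univ.filter fun h : G ↦ ConjClasses.mk h = ConjClasses.mk g).Nonempty :=
      ⟨g, by simp⟩
    exact Nat.cast_ne_zero.2 this.card_ne_zero
  -- A functional φ vanishing on all characters becomes a class function orthogonal to them;
  -- dividing by the class size makes the sum over G equal to the sum over classes.
  let f (g : G) : ℂ := φ (Pi.single (ConjClasses.mk g) 1) / N (ConjClasses.mk g)
  have hφe (h : ConjClasses G → ℂ) : φ h = ∑ C, φ (Pi.single C 1) * h C := by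
    conv_lhs => rw [pi_eq_sum_univ' h, map_sum]
    refine Finset.sum_congr rfl fun C _ ↦ ?_
    rw [map_smul, smul_eq_mul, mul_comm]
  have hf0 : f = 0 := by
    refine eq_zero_of_sum_mul_eq_zero (fun g h ↦ ?_) fun χ hχ ↦ ?_
    · have : ConjClasses.mk (h * g * h⁻¹) = ConjClasses.mk g :=
        (ConjClasses.mk_eq_mk_iff_isConj.2 (isConj_iff.2 ⟨h, rfl⟩)).symm
      simp only [f, this]
    · have h0 : φ (Irr.onClasses ⟨χ, hχ⟩) = 0 :=
        hle (Submodule.subset_span ⟨⟨χ, hχ⟩, rfl⟩)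
      rw [hφe] at h0
      rw [← h0, ← Finset.sum_fiberwise (s := Finset.univ) (g := fun g : G ↦ ConjClasses.mk g)]
      refine Finset.sum_congr rfl fun C _ ↦ ?_
      have (g) (hg : g ∈ Finset.univ.filter fun g : G ↦ ConjClasses.mk g = C) :
          f g * χ g = φ (Pi.single C 1) / N C * Irr.onClasses ⟨χ, hχ⟩ C := by
        simp only [Finset.mem_filter, Finset.mem_univ, true_and] at hg
        subst hg
        rfl
      rw [Finset.sum_congr rfl this, Finset.sum_const, nsmul_eq_mul]
      change N C * _ = _
      field_simp [hN C]
  refine hφ (LinearMap.ext fun h ↦ ?_)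
  rw [hφe, LinearMap.zero_apply]
  refine Finset.sum_eq_zero fun C _ ↦ ?_
  obtain ⟨g, rfl⟩ := ConjClasses.mk_surjective C
  have : f g = 0 := congrFun hf0 g
  rw [div_eq_zero_iff, or_iff_left (hN _)] at this
  rw [this, zero_mul]

/-- The irreducible characters form a basis of the space of class functions. -/
noncomputable def irrBasis (G : Type*) [Group G] [Finite G] :
    Basis (Irr G) ℂ (ConjClasses G → ℂ) :=
  Basis.mk linearIndependent_onClasses span_onClasses.ge

@[simp]
theorem irrBasis_apply [Finite G] (χ : Irr G) : irrBasis G χ = Irr.onClasses χ := by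
  simp [irrBasis]

instance finite_Irr [Finite G] : Finite (Irr G) := Module.Finite.finite_basis (irrBasis G)

theorem eq_of_forall_onClasses_eq [Finite G] {C D : ConjClasses G}
    (h : ∀ χ : Irr G, Irr.onClasses χ C = Irr.onClasses χ D) : C = D := by
  classical
  have key : LinearMap.proj (R := ℂ) (φ := fun _ : ConjClasses G ↦ ℂ) C = LinearMap.proj D :=
    (irrBasis G).ext fun χ ↦ by simpa using h χ
  by_contra hne
  have := LinearMap.congr_fun key (Pi.single C 1)
  simp [Ne.symm hne] at this

end SemiRational

/-! ### Galois automorphisms and character values. -/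

/-- An automorphism of a subfield of an algebraically closed field extends to the whole field. -/
theorem IsAlgClosed.exists_ringEquiv_extending {E K : Type*} [Field E] [Field K] [Algebra E K]
    [IsAlgClosed K] (σ : E ≃+* E) :
    ∃ τ : K ≃+* K, ∀ x : E, τ (algebraMap E K x) = algebraMap E K (σ x) := by
  obtain ⟨s, hs⟩ := exists_isTranscendenceBasis E K
  let A := Algebra.adjoin E (Set.range (Subtype.val : s → K))
  have : IsAlgClosure A K := IsAlgClosed.isAlgClosure_of_transcendence_basis _ hs
  -- `A` is a polynomial ring over `E` on a transcendence basis: σ acts on coefficients, and the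
  -- result extends because `K` is an algebraic closure of `A`.
  let e : A ≃+* A := (hs.1.aevalEquiv.symm.toRingEquiv.trans
    (MvPolynomial.mapEquiv s σ)).trans hs.1.aevalEquiv.toRingEquiv
  refine ⟨IsAlgClosure.equivOfEquiv K K e, fun x ↦ ?_⟩
  have h1 : e (algebraMap E A x) = algebraMap E A (σ x) := by
    simp [e, MvPolynomial.algebraMap_eq]
    rw [← MvPolynomial.algebraMap_eq, AlgEquiv.commutes]
  rw [IsScalarTower.algebraMap_apply E A K, IsAlgClosure.equivOfEquiv_algebraMap, h1,
    ← IsScalarTower.algebraMap_apply]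

/-- In characteristic zero X^n - 1 is separable, so `T` is semisimple, hence diagonalizable over an
algebraically closed field. -/
theorem Module.End.exists_eigenbasis_of_pow_eq_one {K V : Type*} [Field K] [IsAlgClosed K]
    [CharZero K] [AddCommGroup V] [Module K V] [FiniteDimensional K V] (T : End K V) {n : ℕ}
    (hn : n ≠ 0) (hT : T ^ n = 1) :
    ∃ (m : ℕ) (b : Basis (Fin m) K V) (μ : Fin m → K), ∀ i, T (b i) = μ i • b i := by
  classical
  have hss : T.IsSemisimple := by
    refine Module.End.isSemisimple_of_squarefree_aeval_eq_zero (p := Polynomial.X ^ n - 1) ?_ ?_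
    · exact ((Polynomial.separable_X_pow_sub_C (1 : K) (by exact_mod_cast hn)
        one_ne_zero).squarefree)
    · simp [hT]
  have htop : ⨆ μ, T.eigenspace μ = ⊤ := by
    rw [← Module.End.iSup_maxGenEigenspace_eq_top T]
    simp_rw [hss.isFinitelySemisimple.maxGenEigenspace_eq_eigenspace]
  have hint := DirectSum.isInternal_submodule_of_iSupIndep_of_iSup_eq_top
    T.eigenspaces_iSupIndep htop
  let b := hint.collectedBasis fun μ ↦ finBasis K (T.eigenspace μ)
  have := FiniteDimensional.fintypeBasisIndex b
  have hb (i) : T (b i) = i.1 • b i :=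
    Module.End.mem_eigenspace_iff.1 (hint.collectedBasis_mem _ i)
  let e := Fintype.equivFin (Σ μ : K, Fin (finrank K (T.eigenspace μ)))
  exact ⟨_, b.reindex e, fun i ↦ (e.symm i).1, fun i ↦ by rw [Basis.reindex_apply]; exact hb _⟩

theorem Module.End.pow_apply_of_apply_eq_smul {K V : Type*} [Field K] [AddCommGroup V]
    [Module K V] {T : End K V} {v : V} {μ : K} (h : T v = μ • v) (k : ℕ) :
    (T ^ k) v = μ ^ k • v := by
  induction k with
  | zero => simp
  | succ k ih => rw [pow_succ', Module.End.mul_apply, ih, map_smul, h, smul_smul, pow_succ]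

theorem Module.End.trace_eq_sum_of_eigenbasis {K V ι : Type*} [Field K] [AddCommGroup V]
    [Module K V] [Fintype ι] (b : Basis ι K V) {T : End K V} {μ : ι → K}
    (h : ∀ i, T (b i) = μ i • b i) : LinearMap.trace K V T = ∑ i, μ i := by
  classical
  rw [LinearMap.trace_eq_matrix_trace K b]
  simp [Matrix.trace, LinearMap.toMatrix_apply, h]

/-- A field endomorphism raising all `n`-th roots of unity to the `k`-th power sends the trace of
`T` to the trace of `T ^ k`, for every `T` with `T ^ n = 1`. -/
theorem Module.End.map_trace_eq_trace_pow {K V : Type*} [Field K] [IsAlgClosed K]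
    [CharZero K] [AddCommGroup V] [Module K V] [FiniteDimensional K V] (T : End K V) {n k : ℕ}
    (hn : n ≠ 0) (hT : T ^ n = 1) (τ : K →+* K) (hτ : ∀ ζ : K, ζ ^ n = 1 → τ ζ = ζ ^ k) :
    τ (LinearMap.trace K V T) = LinearMap.trace K V (T ^ k) := by
  obtain ⟨m, b, μ, h⟩ := T.exists_eigenbasis_of_pow_eq_one hn hT
  rw [trace_eq_sum_of_eigenbasis b h,
    trace_eq_sum_of_eigenbasis b fun i ↦ pow_apply_of_apply_eq_smul (h i) k, map_sum]
  refine Finset.sum_congr rfl fun i _ ↦ hτ _ ?_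
  have := pow_apply_of_apply_eq_smul (h i) n
  rw [hT, Module.End.one_apply] at this
  have h0 : (μ i ^ n - 1) • b i = 0 := by rw [sub_smul, ← this, one_smul, sub_self]
  exact sub_eq_zero.1 ((smul_eq_zero.1 h0).resolve_right (b.ne_zero i))

theorem Module.End.trace_mem_of_pow_eq_one {K V F : Type*} [Field K] [IsAlgClosed K]
    [CharZero K] [AddCommGroup V] [Module K V] [FiniteDimensional K V] (T : End K V) {n : ℕ}
    (hn : n ≠ 0) (hT : T ^ n = 1) [SetLike F K] [AddSubmonoidClass F K] (E : F)
    (hE : ∀ ζ : K, ζ ^ n = 1 → ζ ∈ E) : LinearMap.trace K V T ∈ E := by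
  obtain ⟨m, b, μ, h⟩ := T.exists_eigenbasis_of_pow_eq_one hn hT
  rw [trace_eq_sum_of_eigenbasis b h]
  refine sum_mem fun i _ ↦ hE _ ?_
  have := pow_apply_of_apply_eq_smul (h i) n
  rw [hT, Module.End.one_apply] at this
  have h0 : (μ i ^ n - 1) • b i = 0 := by rw [sub_smul, ← this, one_smul, sub_self]
  exact sub_eq_zero.1 ((smul_eq_zero.1 h0).resolve_right (b.ne_zero i))

namespace SemiRational

variable {G : Type*} [Group G]

/-- The Galois conjugate of an irreducible character is an irreducible character. -/
theorem Irr.comp_ringEquiv_mem {χ : G → ℂ} (hχ : χ ∈ Irr G) (τ : ℂ ≃+* ℂ) :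
    (fun g ↦ τ (χ g)) ∈ Irr G := by
  obtain ⟨n, ρ, hρ, rfl⟩ := hχ
  have : RingHomInvPair τ.toRingHom τ.symm.toRingHom := ⟨by ext; simp, by ext; simp⟩
  have : RingHomInvPair τ.symm.toRingHom τ.toRingHom := ⟨by ext; simp, by ext; simp⟩
  -- Coordinatewise τ is only semilinear; it intertwines ρ with the representation whose matrices
  -- are twisted entrywise by τ.
  let e : (Fin n → ℂ) ≃ₛₗ[τ.toRingHom] (Fin n → ℂ) :=
    { toFun := fun v i ↦ τ (v i)
      invFun := fun v i ↦ τ.symm (v i)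
      map_add' := fun v w ↦ by ext; simp
      map_smul' := fun c v ↦ by ext; simp
      left_inv := fun v ↦ by ext; simp
      right_inv := fun v ↦ by ext; simp }
  let σ : Representation ℂ G (Fin n → ℂ) :=
    { toFun := fun g ↦ (LinearMap.toMatrix' (ρ g)).map τ |>.toLin'
      map_one' := by simp; rfl
      map_mul' := fun a b ↦ by
        rw [map_mul, LinearMap.toMatrix'_mul, Matrix.map_mul, Matrix.toLin'_mul]
        rfl }
  refine ⟨n, σ, hρ.of_semilinearEquiv e fun g v ↦ ?_, ?_⟩
  · change (fun i ↦ τ (ρ g v i)) = ((LinearMap.toMatrix' (ρ g)).map τ).toLin' (fun i ↦ τ (v i))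
    conv_lhs => rw [← Matrix.toLin'_toMatrix' (ρ g)]
    ext i
    simp [Matrix.mulVec, dotProduct, -Matrix.toLin'_toMatrix']
  · ext g
    change LinearMap.trace ℂ _ ((LinearMap.toMatrix' (ρ g)).map τ).toLin' =
      τ (LinearMap.trace ℂ _ (ρ g))
    rw [Matrix.trace_toLin'_eq, LinearMap.trace_eq_matrix_trace ℂ (Pi.basisFun ℂ (Fin n)) (ρ g)]
    simp [Matrix.trace, LinearMap.toMatrix'_apply]

theorem Irr.map_apply_eq_apply_pow {χ : G → ℂ} (hχ : χ ∈ Irr G) {n k : ℕ} (hn : n ≠ 0)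
    (τ : ℂ →+* ℂ) (hτ : ∀ ζ : ℂ, ζ ^ n = 1 → τ ζ = ζ ^ k) {g : G} (hg : g ^ n = 1) :
    τ (χ g) = χ (g ^ k) := by
  obtain ⟨m, ρ, -, rfl⟩ := hχ
  have := Module.End.map_trace_eq_trace_pow (ρ g) hn (by rw [← map_pow, hg, map_one]) τ hτ
  rwa [← map_pow] at this

theorem Irr.apply_mem {χ : G → ℂ} (hχ : χ ∈ Irr G) {n : ℕ} (hn : n ≠ 0)
    (E : IntermediateField ℚ ℂ) (hE : ∀ ζ : ℂ, ζ ^ n = 1 → ζ ∈ E) {g : G} (hg : g ^ n = 1) :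
    χ g ∈ E := by
  obtain ⟨m, ρ, -, rfl⟩ := hχ
  exact Module.End.trace_mem_of_pow_eq_one (ρ g) hn (by rw [← map_pow, hg, map_one]) E hE

end SemiRational

/-- If a group acting on `X` through the Galois group of `E` permutes a separating family of
`E`-valued vectors, then the degree of the field generated by the entries of a vector is the index
of the stabilizer. -/
theorem IntermediateField.finrank_adjoin_range_eq_index_stabilizer {F K U X ι : Type*} [Field F]
    [Field K] [Algebra F K] [Group U] [MulAction U X] (E : IntermediateField F K)
    [FiniteDimensional F E] [IsGalois F E] (s : U ≃* Gal(E/F)) (f : X → ι → E)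
    (hf : Function.Injective f) (hs : ∀ u x i, f (u • x) i = s u (f x i)) (x : X) :
    finrank F (IntermediateField.adjoin F (Set.range fun i ↦ (f x i : K))) =
      (MulAction.stabilizer U x).index := by
  let L : IntermediateField F E := IntermediateField.adjoin F (Set.range (f x))
  have hL : L.map E.val = IntermediateField.adjoin F (Set.range fun i ↦ (f x i : K)) := by
    rw [IntermediateField.adjoin_map, ← Set.range_comp]
    rfl
  -- Since `f` separates points, u fixes x exactly when `s u` fixes every entry of `f x`, that is,
  -- fixes `L` pointwise.
  have hst : MulAction.stabilizer U x = L.fixingSubgroup.comap s.toMonoidHom := by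
    ext u
    rw [MulAction.mem_stabilizer_iff, Subgroup.mem_comap, IntermediateField.mem_fixingSubgroup_iff,
      ← hf.eq_iff]
    have := IntermediateField.forall_mem_adjoin_smul_eq_self_iff F (S := Set.range (f x)) (s u)
    refine Iff.trans ?_ this.symm
    rw [Set.forall_mem_range, funext_iff]
    exact forall_congr' fun i ↦ by rw [hs]; rfl
  rw [← hL, ← (L.equivMap E.val).toLinearEquiv.finrank_eq, hst,
    Subgroup.index_comap_of_surjective _ s.surjective,
    IntermediateField.finrank_eq_fixingSubgroup_index]

/-- `E` is the cyclotomic field, where the Galois correspondence applies. The extensions τ to all of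
`K` are needed to conjugate matrices with entries outside `E`. -/
theorem IsPrimitiveRoot.exists_galois_units_zmod {F K : Type*} [Field F] [Field K] [Algebra F K]
    [IsAlgClosed K] {n : ℕ} [NeZero n] {ζ : K} (hζ : IsPrimitiveRoot ζ n)
    (hirr : Irreducible (Polynomial.cyclotomic n F)) :
    ∃ (E : IntermediateField F K) (_ : FiniteDimensional F E) (_ : IsGalois F E)
      (s : (ZMod n)ˣ ≃* Gal(E/F)) (τ : (ZMod n)ˣ → (K ≃+* K)),
      (∀ ζ : K, ζ ^ n = 1 → ζ ∈ E) ∧ (∀ u, ∀ x : E, τ u x = s u x) ∧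
      ∀ u, ∀ ζ : K, ζ ^ n = 1 → τ u ζ = ζ ^ u.val.val := by
  let E : IntermediateField F K := IntermediateField.adjoin F {ζ}
  have hcyc : IsCyclotomicExtension {n} F E := by
    change IsCyclotomicExtension {n} F (IntermediateField.adjoin F {ζ}).toSubalgebra
    rw [IntermediateField.adjoin_simple_toSubalgebra_of_isAlgebraic
      (hζ.isIntegral (NeZero.pos n)).tower_top.isAlgebraic]
    exact hζ.adjoin_isCyclotomicExtension F
  have hζE : ζ ∈ E := IntermediateField.mem_adjoin_simple_self F ζ
  have hE (ξ : K) (h : ξ ^ n = 1) : ξ ∈ E := by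
    obtain ⟨i, -, rfl⟩ := hζ.eq_pow_of_pow_eq_one h
    exact pow_mem hζE i
  have hfin : FiniteDimensional F E := IsCyclotomicExtension.finiteDimensional {n} F E
  have hgal : IsGalois F E := IsCyclotomicExtension.isGalois {n} F E
  let s := (IsCyclotomicExtension.autEquivPow E hirr).symm
  have hs (u : (ZMod n)ˣ) (x : E) (hx : x ^ n = 1) : s u x = x ^ u.val.val := by
    have hz := IsCyclotomicExtension.zeta_spec n F E
    obtain ⟨i, -, rfl⟩ := hz.eq_pow_of_pow_eq_one hx
    have h := hz.autToPow_spec F (s u)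
    have h' : hz.autToPow F (s u) = u :=
      (IsCyclotomicExtension.autEquivPow E hirr).apply_symm_apply u
    rw [h'] at h
    rw [map_pow, ← h, ← pow_mul, ← pow_mul, mul_comm]
  choose τ hτ using fun u ↦ IsAlgClosed.exists_ringEquiv_extending (K := K) (s u).toRingEquiv
  refine ⟨E, hfin, hgal, s, τ, hE, hτ, fun u ξ hξ ↦ ?_⟩
  have h := hτ u ⟨ξ, hE ξ hξ⟩
  have hs' := hs u ⟨ξ, hE ξ hξ⟩ (Subtype.ext hξ)
  exact h.trans (congrArg Subtype.val hs')

/-! ### The power action of the units modulo |G| and field degrees. -/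

namespace SemiRational

variable {G : Type*} [Group G]

theorem pow_val_mul [Finite G] (u v : (ZMod (Nat.card G))ˣ) (x : G) :
    x ^ (u * v).val.val = (x ^ v.val.val) ^ u.val.val := by
  rw [← pow_mul, pow_eq_pow_iff_modEq]
  refine Nat.ModEq.of_dvd (orderOf_dvd_natCard x) ?_
  rw [Units.val_mul, ZMod.val_mul, mul_comm v.val.val]
  exact Nat.mod_modEq _ _

theorem pow_val_one [Finite G] (x : G) : x ^ (1 : (ZMod (Nat.card G))ˣ).val.val = x := by
  conv_rhs => rw [← pow_one x]
  rw [pow_eq_pow_iff_modEq]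
  refine Nat.ModEq.of_dvd (orderOf_dvd_natCard x) ?_
  rw [← ZMod.natCast_eq_natCast_iff]
  simp

/-- The units modulo `|G|` act on the conjugacy classes by taking powers. -/
noncomputable instance [Finite G] : MulAction (ZMod (Nat.card G))ˣ (ConjClasses G) where
  smul u := Quotient.map (· ^ u.val.val) fun _ _ h ↦ h.pow _
  one_smul C := by
    obtain ⟨x, rfl⟩ := ConjClasses.mk_surjective C
    exact congrArg ConjClasses.mk (pow_val_one x)
  mul_smul u v C := by
    obtain ⟨x, rfl⟩ := ConjClasses.mk_surjective C
    exact congrArg ConjClasses.mk (pow_val_mul u v x)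

theorem Irr.comp_pow_mem [Finite G] {χ : G → ℂ} (hχ : χ ∈ Irr G) (u : (ZMod (Nat.card G))ˣ) :
    (fun g ↦ χ (g ^ u.val.val)) ∈ Irr G := by
  obtain ⟨-, -, -, -, τ, -, -, hτ⟩ :=
    (Complex.isPrimitiveRoot_exp (Nat.card G) Nat.card_pos.ne').exists_galois_units_zmod
      (Polynomial.cyclotomic.irreducible_rat Nat.card_pos)
  convert Irr.comp_ringEquiv_mem hχ (τ u) with g
  exact (Irr.map_apply_eq_apply_pow hχ Nat.card_pos.ne' (τ u).toRingHom (hτ u)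
    pow_card_eq_one').symm

/-- The units modulo `|G|` act on the irreducible characters by Galois conjugation. -/
noncomputable instance [Finite G] : MulAction (ZMod (Nat.card G))ˣ (Irr G) where
  smul u χ := ⟨fun g ↦ χ.1 (g ^ u.val.val), Irr.comp_pow_mem χ.2 u⟩
  one_smul χ := Subtype.ext (funext fun g ↦ congrArg χ.1 (pow_val_one g))
  mul_smul u v χ := Subtype.ext (funext fun g ↦ by
    change χ.1 _ = χ.1 _
    -- Precomposition reverses the order of products; commutativity of the unit group restores a
    -- left action.
    rw [mul_comm, pow_val_mul])

theorem onClasses_units_smul [Finite G] (u : (ZMod (Nat.card G))ˣ) (χ : Irr G)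
    (C : ConjClasses G) : Irr.onClasses (u • χ) C = Irr.onClasses χ (u • C) := by
  obtain ⟨x, rfl⟩ := ConjClasses.mk_surjective C
  rfl

theorem finrank_charField_eq_index [Finite G] (χ : Irr G) :
    finrank ℚ (charField χ.1) = (MulAction.stabilizer (ZMod (Nat.card G))ˣ χ).index := by
  obtain ⟨E, _, _, s, τ, hE, hs, hτ⟩ :=
    (Complex.isPrimitiveRoot_exp (Nat.card G) Nat.card_pos.ne').exists_galois_units_zmod
      (Polynomial.cyclotomic.irreducible_rat Nat.card_pos)
  have hmem (χ : Irr G) (g : G) : χ.1 g ∈ E :=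
    Irr.apply_mem χ.2 Nat.card_pos.ne' E hE pow_card_eq_one'
  rw [charField]
  have key := E.finrank_adjoin_range_eq_index_stabilizer s
    (fun (χ : Irr G) (g : G) ↦ (⟨χ.1 g, hmem χ g⟩ : E))
    (fun χ ψ h ↦ Subtype.ext (funext fun g ↦ congrArg Subtype.val (congrFun h g)))
  refine key (fun u χ g ↦ Subtype.ext ?_) χ
  rw [← hs]
  exact (Irr.map_apply_eq_apply_pow χ.2 Nat.card_pos.ne' (τ u).toRingHom (hτ u)
    pow_card_eq_one').symm

theorem finrank_elementField_eq_index [Finite G] (x : G) :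
    finrank ℚ (elementField x) =
      (MulAction.stabilizer (ZMod (Nat.card G))ˣ (ConjClasses.mk x)).index := by
  obtain ⟨E, _, _, s, τ, hE, hs, hτ⟩ :=
    (Complex.isPrimitiveRoot_exp (Nat.card G) Nat.card_pos.ne').exists_galois_units_zmod
      (Polynomial.cyclotomic.irreducible_rat Nat.card_pos)
  have hmem (C : ConjClasses G) (χ : Irr G) : Irr.onClasses χ C ∈ E := by
    obtain ⟨g, rfl⟩ := ConjClasses.mk_surjective C
    exact Irr.apply_mem χ.2 Nat.card_pos.ne' E hE pow_card_eq_one'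
  have hset : {z : ℂ | ∃ χ ∈ Irr G, χ x = z} =
      Set.range fun χ : Irr G ↦ Irr.onClasses χ (ConjClasses.mk x) := by
    ext z
    exact ⟨fun ⟨χ, hχ, h⟩ ↦ ⟨⟨χ, hχ⟩, h⟩, fun ⟨χ, h⟩ ↦ ⟨χ.1, χ.2, h⟩⟩
  rw [elementField, hset]
  -- The separation hypothesis holds because irreducible characters distinguish conjugacy classes.
  refine E.finrank_adjoin_range_eq_index_stabilizer s (fun C χ ↦ ⟨Irr.onClasses χ C, hmem C χ⟩)
    (fun C D h ↦ eq_of_forall_onClasses_eq fun χ ↦ congrArg Subtype.val (congrFun h χ))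
    (fun u C χ ↦ Subtype.ext ?_) (ConjClasses.mk x)
  rw [← hs]
  obtain ⟨g, rfl⟩ := ConjClasses.mk_surjective C
  exact (Irr.map_apply_eq_apply_pow χ.2 Nat.card_pos.ne' (τ u).toRingHom (hτ u)
    pow_card_eq_one').symm

end SemiRational

/-! ### Brauer's permutation lemma. -/

theorem LinearMap.trace_eq_card_fixed_of_permutes_basis {R M ι : Type*} [CommRing R]
    [AddCommGroup M] [Module R M] [Finite ι] (b : Basis ι R M) (T : M →ₗ[R] M)
    (π : ι → ι) (hT : ∀ i, T (b i) = b (π i)) :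
    LinearMap.trace R M T = Nat.card {i // π i = i} := by
  classical
  have := Fintype.ofFinite ι
  rw [LinearMap.trace_eq_matrix_trace R b, Matrix.trace]
  simp [LinearMap.toMatrix_apply, hT, Finsupp.single_apply, Fintype.card_subtype]

namespace SemiRational

variable {G : Type*} [Group G]

/-- Brauer's permutation lemma for the power action. -/
theorem card_fixedBy_Irr_eq [Finite G] (u : (ZMod (Nat.card G))ˣ) :
    Nat.card (MulAction.fixedBy (Irr G) u) = Nat.card (MulAction.fixedBy (ConjClasses G) u) := by
  classical
  let T : (ConjClasses G → ℂ) →ₗ[ℂ] (ConjClasses G → ℂ) :=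
    LinearMap.funLeft ℂ ℂ fun C ↦ u • C
  have h1 := LinearMap.trace_eq_card_fixed_of_permutes_basis (irrBasis G) T (fun χ ↦ u • χ)
    fun χ ↦ by
      ext C
      simp [T, onClasses_units_smul]
  have := Fintype.ofFinite (ConjClasses G)
  -- The pullback along u of the indicator of C is the indicator of u⁻¹C; u and u⁻¹ have the same
  -- fixed points.
  have h2 := LinearMap.trace_eq_card_fixed_of_permutes_basis
    (Pi.basisFun ℂ (ConjClasses G)) T (fun C ↦ u⁻¹ • C) fun C ↦ by
      ext D
      simp [T, Pi.single_apply, eq_inv_smul_iff]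
  rw [h1] at h2
  have h3 : Nat.card {χ : Irr G // u • χ = χ} = Nat.card {C : ConjClasses G // u⁻¹ • C = C} := by
    exact_mod_cast h2
  refine h3.trans (Nat.card_congr (Equiv.subtypeEquivRight fun C ↦ ?_))
  rw [inv_smul_eq_iff, MulAction.mem_fixedBy, eq_comm]

end SemiRational

/-! ### Counting when all orbits have at most two elements. -/

theorem MulAction.sum_card_fixedBy_eq_sum_card_stabilizer (U X : Type*) [Group U] [Fintype U]
    [MulAction U X] [Fintype X] :
    ∑ u : U, Nat.card (MulAction.fixedBy X u) =
      ∑ x : X, Nat.card (MulAction.stabilizer U x) := by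
  classical
  simp only [Nat.card_eq_fintype_card, Fintype.card_subtype, MulAction.mem_fixedBy,
    MulAction.mem_stabilizer_iff, Finset.card_filter]
  exact Finset.sum_comm

/-- If all orbits have at most two elements, then twice the number of fixed points plus the number
of points in two-element orbits is determined by the numbers of fixed points of group elements. -/
theorem MulAction.two_mul_sum_card_fixedBy {U X : Type*} [Group U] [Fintype U]
    [MulAction U X] [Fintype X]
    (h : ∀ x : X, (stabilizer U x).index = 1 ∨ (stabilizer U x).index = 2) :
    2 * ∑ u : U, Nat.card (fixedBy X u) =
      Nat.card U * (2 * {x : X | (stabilizer U x).index = 1}.ncard +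
        {x : X | (stabilizer U x).index = 2}.ncard) := by
  classical
  rw [sum_card_fixedBy_eq_sum_card_stabilizer, Set.ncard_eq_toFinset_card',
    Set.ncard_eq_toFinset_card', Set.toFinset_ofPred, Set.toFinset_ofPred, Finset.card_filter,
    Finset.card_filter, Finset.mul_sum, Finset.mul_sum, ← Finset.sum_add_distrib, Finset.mul_sum]
  refine Finset.sum_congr rfl fun x _ ↦ ?_
  rw [← (stabilizer U x).card_mul_index]
  rcases h x with hx | hx <;> simp [hx, mul_comm]

theorem MulAction.ncard_add_ncard_of_index {U X : Type*} [Group U]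
    [MulAction U X] [Finite X]
    (h : ∀ x : X, (stabilizer U x).index = 1 ∨ (stabilizer U x).index = 2) :
    {x : X | (stabilizer U x).index = 1}.ncard + {x : X | (stabilizer U x).index = 2}.ncard =
      Nat.card X := by
  rw [← Set.ncard_univ, ← Set.ncard_union_eq]
  · congr 1
    ext x
    simpa using h x
  · rw [Set.disjoint_left]
    intro x hx hx'
    rw [Set.mem_ofPred_eq] at hx hx'
    omega

theorem MulAction.ncard_index_eq_of_card_fixedBy_eq {U X Y : Type*} [Group U] [Finite U]
    [MulAction U X] [Finite X] [MulAction U Y] [Finite Y]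
    (hfix : ∀ u : U, Nat.card (fixedBy X u) = Nat.card (fixedBy Y u))
    (hX : ∀ x : X, (stabilizer U x).index = 1 ∨ (stabilizer U x).index = 2)
    (hY : ∀ y : Y, (stabilizer U y).index = 1 ∨ (stabilizer U y).index = 2) :
    {x : X | (stabilizer U x).index = 1}.ncard = {y : Y | (stabilizer U y).index = 1}.ncard ∧
    {x : X | (stabilizer U x).index = 2}.ncard = {y : Y | (stabilizer U y).index = 2}.ncard := by
  have := Fintype.ofFinite U
  have := Fintype.ofFinite X
  have := Fintype.ofFinite Y
  have hX2 := two_mul_sum_card_fixedBy hX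
  have hY2 := two_mul_sum_card_fixedBy hY
  rw [Finset.sum_congr rfl fun u _ ↦ hfix u, hY2] at hX2
  have h2 := Nat.eq_of_mul_eq_mul_left Nat.card_pos hX2
  have hX1 := ncard_add_ncard_of_index hX
  have hY1 := ncard_add_ncard_of_index hY
  have hc : Nat.card X = Nat.card Y := by
    have h1 := hfix 1
    rw [fixedBy_one_eq_univ, fixedBy_one_eq_univ, Nat.card_coe_set_eq, Nat.card_coe_set_eq,
      Set.ncard_univ, Set.ncard_univ] at h1
    exact h1
  omega

/-! ### Application to semi-rational groups. -/

namespace SemiRational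

variable {G : Type*} [Group G]

theorem ncard_Irr_charField [Finite G] (k : ℕ) :
    {χ : G → ℂ | χ ∈ Irr G ∧ finrank ℚ (charField χ) = k}.ncard =
      {χ : Irr G | (MulAction.stabilizer (ZMod (Nat.card G))ˣ χ).index = k}.ncard := by
  rw [← Set.ncard_image_of_injective _ Subtype.val_injective]
  congr 1
  ext χ
  constructor
  · rintro ⟨hχ, h⟩
    exact ⟨⟨χ, hχ⟩, (finrank_charField_eq_index ⟨χ, hχ⟩).symm.trans h, rfl⟩
  · rintro ⟨ψ, h, rfl⟩
    exact ⟨ψ.2, (finrank_charField_eq_index ψ).trans h⟩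

theorem setOf_elementField_eq [Finite G] (k : ℕ) :
    {C : ConjClasses G | ∃ x : G, ConjClasses.mk x = C ∧ finrank ℚ (elementField x) = k} =
      {C | (MulAction.stabilizer (ZMod (Nat.card G))ˣ C).index = k} := by
  ext C
  constructor
  · rintro ⟨x, rfl, h⟩
    exact (finrank_elementField_eq_index x).symm.trans h
  · intro h
    obtain ⟨x, rfl⟩ := ConjClasses.mk_surjective C
    exact ⟨x, rfl, (finrank_elementField_eq_index x).trans h⟩

theorem ncard_rationalIrr [Finite G] : (rationalIrr G).ncard =
    {χ : Irr G | (MulAction.stabilizer (ZMod (Nat.card G))ˣ χ).index = 1}.ncard := by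
  simp only [← ncard_Irr_charField, IntermediateField.finrank_eq_one_iff]
  rfl

theorem rationalClasses_eq [Finite G] : rationalClasses G =
    {C | (MulAction.stabilizer (ZMod (Nat.card G))ˣ C).index = 1} := by
  simp only [← setOf_elementField_eq, IntermediateField.finrank_eq_one_iff]
  rfl

theorem zpowers_pow_val [Finite G] (u : (ZMod (Nat.card G))ˣ) (x : G) :
    Subgroup.zpowers (x ^ u.val.val) = Subgroup.zpowers x := by
  refine le_antisymm (by simp) ?_
  rw [Subgroup.zpowers_le]
  refine ⟨(u⁻¹).val.val, ?_⟩
  simp only [zpow_natCast]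
  rw [← pow_val_mul, inv_mul_cancel, pow_val_one]

theorem index_stabilizer_of_isSemiRational [Finite G] (h : IsSemiRational G)
    (C : ConjClasses G) :
    (MulAction.stabilizer (ZMod (Nat.card G))ˣ C).index = 1 ∨
      (MulAction.stabilizer (ZMod (Nat.card G))ˣ C).index = 2 := by
  obtain ⟨x, rfl⟩ := ConjClasses.mk_surjective C
  obtain ⟨D, E, hDE⟩ := h x
  have hsub : MulAction.orbit (ZMod (Nat.card G))ˣ (ConjClasses.mk x) ⊆ {D, E} := by
    rintro _ ⟨u, rfl⟩
    exact hDE _ (zpowers_pow_val u x)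
  have hle := (Set.ncard_le_ncard hsub).trans ((Set.ncard_insert_le D {E}).trans_eq
    (by rw [Set.ncard_singleton]))
  rw [← MulAction.index_stabilizer] at hle
  have := (MulAction.stabilizer (ZMod (Nat.card G))ˣ (ConjClasses.mk x)).index_ne_zero_of_finite
  omega

theorem ncard_index_eq_of_isQuadraticSemiRational [Finite G] (h : IsQuadraticSemiRational G) :
    {χ : Irr G | (MulAction.stabilizer (ZMod (Nat.card G))ˣ χ).index = 1}.ncard =
      {C : ConjClasses G | (MulAction.stabilizer (ZMod (Nat.card G))ˣ C).index = 1}.ncard ∧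
    {χ : Irr G | (MulAction.stabilizer (ZMod (Nat.card G))ˣ χ).index = 2}.ncard =
      {C : ConjClasses G | (MulAction.stabilizer (ZMod (Nat.card G))ˣ C).index = 2}.ncard := by
  refine MulAction.ncard_index_eq_of_card_fixedBy_eq card_fixedBy_Irr_eq (fun χ ↦ ?_)
    (index_stabilizer_of_isSemiRational h.1)
  rw [← finrank_charField_eq_index, IntermediateField.finrank_eq_one_iff]
  exact h.2 χ.1 χ.2

/-- The given m need not be prime to |G|. It matters only for x whose order is prime to m: otherwise
x^m has smaller order than x, so no generator of ⟨x⟩ is conjugate to it. -/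
theorem exists_unit_of_isUniformlySemiRational [Finite G] (h : IsUniformlySemiRational G) :
    ∃ u : (ZMod (Nat.card G))ˣ, ∀ x y : G, Subgroup.zpowers y = Subgroup.zpowers x →
      IsConj y x ∨ IsConj y (x ^ u.val.val) := by
  classical
  have := Fintype.ofFinite G
  obtain ⟨m, hm⟩ := h
  let S : Finset G := Finset.univ.filter fun x ↦ (orderOf x).Coprime m.natAbs
  -- m is a unit modulo this lcm `N` of the relevant orders. As `N` divides |G|, the unit lifts to
  -- one modulo |G| with the same powers on `S`.
  let N := S.lcm orderOf
  have hNG : N ∣ Nat.card G := Finset.lcm_dvd fun x _ ↦ orderOf_dvd_natCard x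
  have hNm : N.Coprime m.natAbs := by
    have hprod : (∏ x ∈ S, orderOf x).Coprime m.natAbs :=
      Nat.Coprime.prod_left fun x hx ↦ (Finset.mem_filter.1 hx).2
    exact hprod.coprime_dvd_left (Finset.lcm_dvd fun x hx ↦ Finset.dvd_prod_of_mem _ hx)
  have hunit : IsUnit ((m : ℤ) : ZMod N) := by
    rw [ZMod.coe_int_isUnit_iff_isCoprime, Int.isCoprime_iff_nat_coprime]
    simpa using hNm
  obtain ⟨u, hu⟩ := ZMod.unitsMap_surjective hNG hunit.unit
  have hum : ((u.val.val : ℤ) : ZMod N) = (m : ZMod N) := by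
    have := congrArg Units.val hu
    rw [ZMod.unitsMap_val, IsUnit.unit_spec] at this
    rw [← this, Int.cast_natCast, ZMod.natCast_val]
  refine ⟨u, fun x y hxy ↦ ?_⟩
  by_cases hx : (orderOf x).Coprime m.natAbs
  · have hpow : x ^ u.val.val = x ^ m := by
      rw [← zpow_natCast, zpow_eq_zpow_iff_modEq]
      refine Int.ModEq.of_dvd ?_ ((ZMod.intCast_eq_intCast_iff _ _ _).1 hum)
      exact_mod_cast Finset.dvd_lcm (f := orderOf) (Finset.mem_filter.2 ⟨Finset.mem_univ x, hx⟩)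
    rw [hpow]
    exact hm x y hxy
  · refine Or.inl ((hm x y hxy).resolve_right fun hc ↦ hx ?_)
    have ho : orderOf (x ^ m.natAbs) = orderOf x := by
      have h1 : orderOf (x ^ m) = orderOf (x ^ m.natAbs) := by
        rcases Int.natAbs_eq m with h | h
        · conv_lhs => rw [h, zpow_natCast]
        · conv_lhs => rw [h, zpow_neg, orderOf_inv, zpow_natCast]
      obtain ⟨c, hc⟩ := isConj_iff.1 hc
      have h2 : orderOf (x ^ m) = orderOf y := by
        rw [← hc]
        exact MulEquiv.orderOf_eq (MulAut.conj c) y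
      rw [← h1, h2, ← Nat.card_zpowers, hxy, Nat.card_zpowers]
    rw [orderOf_pow] at ho
    have hg : 0 < Nat.gcd (orderOf x) m.natAbs := Nat.gcd_pos_of_pos_left _ (orderOf_pos x)
    exact (Nat.div_eq_self.1 ho).resolve_left (orderOf_pos x).ne'

theorem ncard_rational_of_isUniformlySemiRational [Finite G] (h : IsUniformlySemiRational G) :
    (rationalIrr G).ncard = (rationalClasses G).ncard := by
  obtain ⟨u, hu⟩ := exists_unit_of_isUniformlySemiRational h
  have hX : {χ : Irr G | (MulAction.stabilizer (ZMod (Nat.card G))ˣ χ).index = 1} =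
      MulAction.fixedBy (Irr G) u := by
    ext χ
    rw [Set.mem_ofPred_eq, Subgroup.index_eq_one, MulAction.mem_fixedBy, Subgroup.eq_top_iff']
    refine ⟨fun h ↦ h u, fun h v ↦ Subtype.ext (funext fun g ↦ ?_)⟩
    -- Each power g^v generates ⟨g⟩, so it is conjugate to g or g^u; invariance under u alone
    -- therefore gives invariance under every v.
    rcases hu g (g ^ v.val.val) (zpowers_pow_val v g) with hc | hc
    · exact Irr.apply_eq_of_isConj χ.2 hc
    · exact (Irr.apply_eq_of_isConj χ.2 hc).trans (congrFun (congrArg Subtype.val h) g)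
  have hY : {C : ConjClasses G | (MulAction.stabilizer (ZMod (Nat.card G))ˣ C).index = 1} =
      MulAction.fixedBy (ConjClasses G) u := by
    ext C
    rw [Set.mem_ofPred_eq, Subgroup.index_eq_one, MulAction.mem_fixedBy, Subgroup.eq_top_iff']
    refine ⟨fun h ↦ h u, fun h v ↦ ?_⟩
    obtain ⟨x, rfl⟩ := ConjClasses.mk_surjective C
    rcases hu x (x ^ v.val.val) (zpowers_pow_val v x) with hc | hc
    · exact ConjClasses.mk_eq_mk_iff_isConj.2 hc
    · exact (ConjClasses.mk_eq_mk_iff_isConj.2 hc).trans h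
  rw [ncard_rationalIrr, rationalClasses_eq, hX, hY]
  exact card_fixedBy_Irr_eq u

end SemiRational

theorem mainTheorem7 (G : Type*) [Group G] [Finite G] :
    (SemiRational.IsQuadraticSemiRational G →
      (SemiRational.rationalIrr G).ncard = (SemiRational.rationalClasses G).ncard) ∧
    (SemiRational.IsUniformlySemiRational G →
      (SemiRational.rationalIrr G).ncard = (SemiRational.rationalClasses G).ncard) ∧
    (SemiRational.IsQuadraticSemiRational G →
      (SemiRational.quadraticIrr G).ncard = (SemiRational.quadraticClasses G).ncard) := by
  refine ⟨fun h ↦ ?_, SemiRational.ncard_rational_of_isUniformlySemiRational, fun h ↦ ?_⟩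
  · rw [SemiRational.ncard_rationalIrr, SemiRational.rationalClasses_eq]
    exact (SemiRational.ncard_index_eq_of_isQuadraticSemiRational h).1
  · exact ((SemiRational.ncard_Irr_charField 2).trans
      (SemiRational.ncard_index_eq_of_isQuadraticSemiRational h).2).trans
        (congrArg Set.ncard (SemiRational.setOf_elementField_eq 2).symm)
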